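/- Let $N\subseteq M$ be von Neumann algebras and let $E:M\to N$ be a faithful normal conditional expectation onto $N$. Let $\mathcal U_M$ be the unitary group of $M$ with the norm topology and, for $u\in\mathcal U_M$, let $L_u(E)=uE(u^*\,\cdot\,u)u^*$. Put $$\mathcal N_E=\{u\in\mathcal U_M : E(uxu^*)=uE(x)u^* \text{ for all } x\in M\},\qquad M_E=\{x\in N'\cap M : E(xm)=E(mx)\text{ for all } m\in M\},$$ $$\mathcal H_E=\mathcal U_N\cdot\mathcal U_{M_E}=\{vw : v\in\mathcal U_N,\ w\in\mathcal U_{M_E}\},$$ where $\mathcal H_E$ is a normal subgroup of the group $\mathcal N_E$, and let $W(E)=\mathcal N_E/\mathcal H_E$ be the Weyl group of $E$. Let $\mathcal X(E)=\mathcal U_M/\mathcal H_E$ be the space of left cosets with the quotient topology, and let $\mathcal U(E)=\{L_u(E):u\in\mathcal U_M\}$ be the unitary orbit of $E$ with the quotient topology induced by the map $u\mapsto L_u(E)$ from $\mathcal U_M$. Then the map $u\,\mathcal N_E\mapsto L_u(E)$ is a homeomorphism $\mathcal U_M/\mathcal N_E\cong\mathcal U(E)$, and the map $$\Phi:\mathcal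 X(E)\to\mathcal U(E),\qquad \Phi(u\mathcal H_E)=L_u(E),$$ is a surjective covering map. Its group of covering transformations (the homeomorphisms $f$ of $\mathcal X(E)$ with $\Phi\circ f=\Phi$) is the Weyl group $W(E)$ acting by right multiplication: $g\mathcal H_E\mapsto\bigl(u\mathcal H_E\mapsto ug^{-1}\mathcal H_E\bigr)$ is a well-defined group isomorphism from $W(E)$ onto it. -/

import Mathlib

/-!
# The unitary orbit of a conditional expectation and its covering space

Von Neumann algebras are concrete: `M : VonNeumannAlgebra H` is a unital `*`-subalgebra of the
bounded operators on the complex Hilbert space `H` that equals its double commutant. The type of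
elements of `M` is `M.toStarSubalgebra`; its norm and its order `≤` (`a ≤ b` iff `b - a` is a
positive operator) are inherited from `H →L[ℂ] H`.
-/

noncomputable section

namespace CondExp

variable {H : Type*} [NormedAddCommGroup H] [InnerProductSpace ℂ H] [CompleteSpace H]

/-- A faithful normal conditional expectation of the von Neumann algebra `M` onto the von Neumann
subalgebra `N`, regarded as a bounded operator on `M` with values in `N`: a positive linear map
that is the identity on `N` and an `N`-bimodule map, is faithful on positive elements `x* x`, and
preserves suprema of (bounded) increasing nets of self-adjoint elements. -/
structure FaithfulNormalCondExp {N M : VonNeumannAlgebra H} (hNM : N ≤ M) where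
  /-- the underlying bounded linear map of `M` into itself -/
  toCLM : M.toStarSubalgebra →L[ℂ] M.toStarSubalgebra
  mem' : ∀ x, (toCLM x : H →L[ℂ] H) ∈ N
  apply_of_mem' : ∀ x : M.toStarSubalgebra, (x : H →L[ℂ] H) ∈ N → toCLM x = x
  bimodule' : ∀ a x b : M.toStarSubalgebra, (a : H →L[ℂ] H) ∈ N → (b : H →L[ℂ] H) ∈ N →
    toCLM (a * x * b) = a * toCLM x * b
  positive' : ∀ x, 0 ≤ x → 0 ≤ toCLM x
  faithful' : ∀ x, toCLM (star x * x) = 0 → x = 0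
  normal' : ∀ (S : Set M.toStarSubalgebra) (x : M.toStarSubalgebra),
    (∀ s ∈ S, IsSelfAdjoint s) → S.Nonempty → DirectedOn (· ≤ ·) S → IsLUB S x →
      IsLUB (toCLM '' S) (toCLM x)

/-- The unitary group `𝒰_M` of `M`, with the norm topology. -/
abbrev UnitaryGroup (M : VonNeumannAlgebra H) : Type _ := unitary M.toStarSubalgebra

/-- The action `L_u(T) = u T(u⁻¹ · u) u⁻¹` of a unitary `u` of `M` on a bounded operator `T`
on `M`; recall that `u⁻¹ = u*`. -/
def conjAction {M : VonNeumannAlgebra H} (u : UnitaryGroup M)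
    (T : M.toStarSubalgebra →L[ℂ] M.toStarSubalgebra) :
    M.toStarSubalgebra →L[ℂ] M.toStarSubalgebra :=
  (ContinuousLinearMap.mulLeftRight ℂ M.toStarSubalgebra
      (u : M.toStarSubalgebra) (star (u : M.toStarSubalgebra))).comp
    (T.comp (ContinuousLinearMap.mulLeftRight ℂ M.toStarSubalgebra
      (star (u : M.toStarSubalgebra)) (u : M.toStarSubalgebra)))

theorem conjAction_apply {M : VonNeumannAlgebra H} (u : UnitaryGroup M)
    (T : M.toStarSubalgebra →L[ℂ] M.toStarSubalgebra) (x : M.toStarSubalgebra) :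
    conjAction u T x = (u : M.toStarSubalgebra) *
      T (star (u : M.toStarSubalgebra) * x * (u : M.toStarSubalgebra)) *
        star (u : M.toStarSubalgebra) := by
  simp [conjAction]

/-- The unitary group `𝒰_N` of the subalgebra `N`, as a subgroup of `𝒰_M`. -/
def unitarySubgroup (M N : VonNeumannAlgebra H) : Subgroup (UnitaryGroup M) where
  carrier := {u | ((u : M.toStarSubalgebra) : H →L[ℂ] H) ∈ N}
  mul_mem' ha hb := mul_mem (S := VonNeumannAlgebra H) ha hb
  one_mem' := one_mem N
  inv_mem' ha := star_mem (S := VonNeumannAlgebra H) ha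

namespace FaithfulNormalCondExp

variable {N M : VonNeumannAlgebra H} {hNM : N ≤ M} (E : FaithfulNormalCondExp hNM)

/-- The unitary orbit `𝒰(E) = {L_u(E) : u ∈ 𝒰_M}`. (It is not given the topology of a subspace of
the space of bounded operators on `M`.) -/
def UnitaryOrbit : Type _ := Set.range fun u : UnitaryGroup M => conjAction u E.toCLM

/-- The fibration `Π_E : 𝒰_M → 𝒰(E)`, `u ↦ L_u(E)`. -/
def orbitMap (u : UnitaryGroup M) : E.UnitaryOrbit := ⟨conjAction u E.toCLM, u, rfl⟩

/-- `𝒰(E)` carries the quotient topology of the norm topology of `𝒰_M` under `Π_E`. -/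
instance : TopologicalSpace E.UnitaryOrbit := TopologicalSpace.coinduced E.orbitMap inferInstance

/-- The normalizer `𝒩_E = {u ∈ 𝒰_M : E(u x u*) = u E(x) u* for all x ∈ M}`. -/
def normalizer : Subgroup (UnitaryGroup M) where
  carrier := {u | ∀ x : M.toStarSubalgebra,
    E.toCLM ((u : M.toStarSubalgebra) * x * star (u : M.toStarSubalgebra)) =
      (u : M.toStarSubalgebra) * E.toCLM x * star (u : M.toStarSubalgebra)}
  mul_mem' {a b} ha hb x := by
    have h1 := ha ((b : M.toStarSubalgebra) * x * star (b : M.toStarSubalgebra))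
    rw [hb x] at h1
    simpa [mul_assoc] using h1
  one_mem' x := by simp
  inv_mem' {a} ha x := by
    have h1 := ha (star (a : M.toStarSubalgebra) * x * (a : M.toStarSubalgebra))
    have h2 : (a : M.toStarSubalgebra) * (star (a : M.toStarSubalgebra) * x * a) *
        star (a : M.toStarSubalgebra) = x := by
      have h := Unitary.mul_star_self_of_mem a.2
      calc _ = ((a : M.toStarSubalgebra) * star (a : M.toStarSubalgebra)) * x *
            ((a : M.toStarSubalgebra) * star (a : M.toStarSubalgebra)) := by
              simp only [mul_assoc]
        _ = x := by rw [h]; simp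
    rw [h2] at h1
    have h := Unitary.star_mul_self_of_mem a.2
    change E.toCLM (star (a : M.toStarSubalgebra) * x * star (star (a : M.toStarSubalgebra))) =
      star (a : M.toStarSubalgebra) * E.toCLM x * star (star (a : M.toStarSubalgebra))
    rw [h1, star_star]
    generalize E.toCLM (star (a : M.toStarSubalgebra) * x * a) = y
    calc y = (star (a : M.toStarSubalgebra) * a) * y * (star (a : M.toStarSubalgebra) * a) := by
            rw [h]; simp
      _ = _ := by simp only [mul_assoc]

/-- The centralizer `M_E = {x ∈ N' ∩ M : E(x m) = E(m x) for all m ∈ M}` of `E`. -/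
def centralizer : Set M.toStarSubalgebra :=
  {x | (x : H →L[ℂ] H) ∈ N.commutant ∧ ∀ m, E.toCLM (x * m) = E.toCLM (m * x)}

/-- The unitary group of `M_E`, as a subgroup of `𝒰_M`. -/
def centralizerUnitary : Subgroup (UnitaryGroup M) where
  carrier := {w | (w : M.toStarSubalgebra) ∈ E.centralizer}
  mul_mem' {a b} ha hb := by
    refine ⟨mul_mem (S := VonNeumannAlgebra H) ha.1 hb.1, fun m => ?_⟩
    have h1 := ha.2 ((b : M.toStarSubalgebra) * m)
    have h2 := hb.2 (m * (a : M.toStarSubalgebra))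
    simp only [Submonoid.coe_mul, mul_assoc] at h1 h2 ⊢
    rw [h1, h2]
  one_mem' := ⟨one_mem N.commutant, fun m => by simp⟩
  inv_mem' {a} ha := by
    refine ⟨star_mem (S := VonNeumannAlgebra H) ha.1, fun m => ?_⟩
    have h1 := ha.2 (star (a : M.toStarSubalgebra) * m * star (a : M.toStarSubalgebra))
    have h := Unitary.mul_star_self_of_mem a.2
    have h' := Unitary.star_mul_self_of_mem a.2
    change E.toCLM (star (a : M.toStarSubalgebra) * m) = E.toCLM (m * star (a : M.toStarSubalgebra))
    rw [mul_assoc _ _ (a : M.toStarSubalgebra), h', mul_one, mul_assoc (star _), ← mul_assoc, h,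
      one_mul] at h1
    exact h1.symm

/-- The group `ℋ_E = 𝒰_N · 𝒰_{M_E} = {v w : v ∈ 𝒰_N, w ∈ 𝒰_{M_E}}`; it is a group because the
elements of `N` commute with those of `M_E`. -/
def prodSubgroup : Subgroup (UnitaryGroup M) where
  carrier := {u | ∃ v ∈ unitarySubgroup M N, ∃ w ∈ E.centralizerUnitary, v * w = u}
  mul_mem' := by
    rintro _ _ ⟨v, hv, w, hw, rfl⟩ ⟨v', hv', w', hw', rfl⟩
    refine ⟨v * v', mul_mem hv hv', w * w', mul_mem hw hw', ?_⟩
    have h : v' * w = w * v' :=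
      Subtype.ext (Subtype.ext (VonNeumannAlgebra.mem_commutant_iff.1 hw.1 _ hv'))
    rw [mul_assoc, ← mul_assoc v' w, h]
    simp only [mul_assoc]
  one_mem' := ⟨1, one_mem _, 1, one_mem _, mul_one 1⟩
  inv_mem' := by
    rintro _ ⟨v, hv, w, hw, rfl⟩
    refine ⟨v⁻¹, inv_mem hv, w⁻¹, inv_mem hw, ?_⟩
    have h : v * w = w * v :=
      Subtype.ext (Subtype.ext (VonNeumannAlgebra.mem_commutant_iff.1 hw.1 _ hv))
    rw [h, mul_inv_rev]

theorem prodSubgroup_le_normalizer : E.prodSubgroup ≤ E.normalizer := by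
  rintro _ ⟨v, hv, w, hw, rfl⟩
  refine mul_mem (fun x => ?_) (fun x => ?_)
  · exact E.bimodule' _ x _ hv (star_mem (S := VonNeumannAlgebra H) hv)
  · have h := Unitary.mul_star_self_of_mem w.2
    have h' := Unitary.star_mul_self_of_mem w.2
    have h1 : (w : M.toStarSubalgebra) * E.toCLM x = E.toCLM x * w :=
      Subtype.ext (VonNeumannAlgebra.mem_commutant_iff.1 hw.1 _ (E.mem' x)).symm
    rw [h1, mul_assoc, mul_assoc, h, mul_one, hw.2, mul_assoc, h', mul_one]

/-- `ℋ_E` is a normal subgroup of `𝒩_E`. -/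
instance normal_prodSubgroup : (E.prodSubgroup.subgroupOf E.normalizer).Normal := by
  have conj_mem : ∀ g ∈ E.normalizer, ∀ y : M.toStarSubalgebra, (y : H →L[ℂ] H) ∈ N →
      (((g : M.toStarSubalgebra) * y * star (g : M.toStarSubalgebra) : M.toStarSubalgebra) :
        H →L[ℂ] H) ∈ N := by
    intro g hg y hy
    have h1 := hg y
    rw [E.apply_of_mem' y hy] at h1
    rw [← h1]
    exact E.mem' _
  refine ⟨?_⟩
  rintro ⟨_, hn⟩ ⟨v, hv, w, hw, rfl⟩ ⟨g, hg⟩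
  refine ⟨g * v * g⁻¹, conj_mem g hg _ hv, g * w * g⁻¹, ⟨?_, fun m => ?_⟩, ?_⟩
  · rw [VonNeumannAlgebra.mem_commutant_iff]
    intro n hn
    have h1 := conj_mem g⁻¹ (inv_mem hg) ⟨n, hNM hn⟩ hn
    have h3 : (star (g : M.toStarSubalgebra) * ⟨n, hNM hn⟩ * star (star (g : M.toStarSubalgebra)))
        * (w : M.toStarSubalgebra) = (w : M.toStarSubalgebra) *
          (star (g : M.toStarSubalgebra) * ⟨n, hNM hn⟩ * star (star (g : M.toStarSubalgebra))) :=
      Subtype.ext (VonNeumannAlgebra.mem_commutant_iff.1 hw.1 _ h1)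
    have h := Unitary.mul_star_self_of_mem g.2
    have h4 : (⟨n, hNM hn⟩ : M.toStarSubalgebra) *
        ((g : M.toStarSubalgebra) * w * star (g : M.toStarSubalgebra)) =
        ((g : M.toStarSubalgebra) * w * star (g : M.toStarSubalgebra)) * ⟨n, hNM hn⟩ := by
      have key := congrArg (fun z => (g : M.toStarSubalgebra) * z * star (g : M.toStarSubalgebra)) h3
      generalize (⟨n, hNM hn⟩ : M.toStarSubalgebra) = y at key ⊢
      generalize (g : M.toStarSubalgebra) = a at key h ⊢
      generalize (w : M.toStarSubalgebra) = b at key ⊢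
      calc y * (a * b * star a) = a * (star a * y * star (star a) * b) * star a := by
            rw [star_star]; simp only [← mul_assoc]; rw [h, one_mul]
        _ = a * (b * (star a * y * star (star a))) * star a := key
        _ = a * b * star a * y * (a * star a) := by
            rw [star_star]; simp only [mul_assoc]
        _ = a * b * star a * y := by rw [h, mul_one]
    exact congrArg Subtype.val h4
  · have h := Unitary.mul_star_self_of_mem g.2
    have hL := hg ((w : M.toStarSubalgebra) * (star (g : M.toStarSubalgebra) * m * g))
    have hR := hg ((star (g : M.toStarSubalgebra) * m * g) * (w : M.toStarSubalgebra))
    rw [hw.2, ← hR] at hL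
    change E.toCLM ((g : M.toStarSubalgebra) * w * star (g : M.toStarSubalgebra) * m) =
      E.toCLM (m * ((g : M.toStarSubalgebra) * w * star (g : M.toStarSubalgebra)))
    generalize (g : M.toStarSubalgebra) = a at hL h ⊢
    generalize (w : M.toStarSubalgebra) = b at hL ⊢
    have e1 : a * (b * (star a * m * a)) * star a = a * b * star a * m := by
      calc _ = a * b * star a * m * (a * star a) := by simp only [mul_assoc]
        _ = _ := by rw [h, mul_one]
    have e2 : a * (star a * m * a * b) * star a = m * (a * b * star a) := by
      calc _ = (a * star a) * (m * (a * b * star a)) := by simp only [mul_assoc]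
        _ = _ := by rw [h, one_mul]
    rwa [e1, e2] at hL
  · simp [mul_assoc]

/-- The space `𝒳(E) = 𝒰_M / ℋ_E` of left cosets, with the quotient topology of the norm
topology. -/
abbrev CoveringSpace : Type _ := UnitaryGroup M ⧸ E.prodSubgroup

/-- The Weyl group `W(E) = 𝒩_E / ℋ_E`. -/
abbrev WeylGroup : Type _ := E.normalizer ⧸ E.prodSubgroup.subgroupOf E.normalizer

theorem orbitMap_eq (u v : UnitaryGroup M) (huv : u⁻¹ * v ∈ E.prodSubgroup) :
    E.orbitMap u = E.orbitMap v := by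
  have hn := E.prodSubgroup_le_normalizer huv
  refine Subtype.ext (ContinuousLinearMap.ext fun x => ?_)
  change conjAction u E.toCLM x = conjAction v E.toCLM x
  rw [conjAction_apply, conjAction_apply]
  have h1 := hn (star (v : M.toStarSubalgebra) * x * v)
  change E.toCLM (star (u : M.toStarSubalgebra) * v * (star (v : M.toStarSubalgebra) * x * v) *
      star (star (u : M.toStarSubalgebra) * v)) =
    star (u : M.toStarSubalgebra) * v * E.toCLM (star (v : M.toStarSubalgebra) * x * v) *
      star (star (u : M.toStarSubalgebra) * v) at h1
  have hu := Unitary.mul_star_self_of_mem u.2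
  have hv := Unitary.mul_star_self_of_mem v.2
  generalize (u : M.toStarSubalgebra) = a at *
  generalize (v : M.toStarSubalgebra) = b at *
  have e1 : star a * b * (star b * x * b) * star (star a * b) = star a * x * a := by
    rw [star_mul, star_star]
    calc _ = star a * (b * star b) * x * (b * star b) * a := by simp only [mul_assoc]
      _ = _ := by rw [hv, mul_one, mul_one]
  rw [e1] at h1
  rw [h1, star_mul, star_star]
  generalize E.toCLM (star b * x * b) = y
  calc _ = (a * star a) * b * y * star b * (a * star a) := by simp only [mul_assoc]
    _ = _ := by rw [hu, one_mul, mul_one]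

/-- The map `Φ : 𝒳(E) → 𝒰(E)`, `Φ(u ℋ_E) = L_u(E)`. -/
def coveringProj : E.CoveringSpace → E.UnitaryOrbit :=
  Quotient.lift E.orbitMap fun u v huv => E.orbitMap_eq u v (QuotientGroup.leftRel_apply.1 huv)

end FaithfulNormalCondExp

/-- The group of covering transformations of a map `p : X → Y`: the homeomorphisms `f` of `X`
with `p ∘ f = p`, under composition. -/
def deckGroup {X Y : Type*} [TopologicalSpace X] (p : X → Y) : Subgroup (X ≃ₜ X) where
  carrier := {f | ∀ x, p (f x) = p x}
  mul_mem' {f g} hf hg x := (hf (g x)).trans (hg x)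
  one_mem' _ := rfl
  inv_mem' {f} hf x := by
    have h := hf (f.symm x)
    rw [Homeomorph.apply_symm_apply] at h
    exact h.symm

end CondExp

end

open CondExp

/-!
Two facts about operators carry the proof; the rest concerns cosets in a topological group.

*Unitaries of the normalizer that are close to `1` lie in `ℋ_E`.* If `u` normalizes `E` and is
close to `1`, then `x = E(u) ∈ N` is close to `E(1) = 1`, hence invertible. Conjugation by `u`
restricts to an automorphism `θ` of `N`, and applying `E` to `u n = θ(n) u` gives
`x n = θ(n) x` for `n ∈ N`. Therefore `x* x` commutes with `N`, and the unitary part `v ∈ N` of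
the polar decomposition of `x` also satisfies `v n = θ(n) v`. So `w = v* u` commutes with `N`; it
normalizes `E` as well, and these two properties together say that `w ∈ M_E`. Thus `u = v w ∈ ℋ_E`
(`FaithfulNormalCondExp.mem_prodSubgroup_of_isUnit`).

*The unitary group of a von Neumann algebra is connected in the norm topology*
(`pathConnectedSpace_unitaryGroup`). Let `p` be the projection onto the kernel of the negative part
of `a = i(u* - u)`. It belongs to the algebra and `(2p - 1) a ≥ 0`, so the unitary
`t = i(2p - 1)` satisfies `(u - t)*(u - t) ≤ 2` and `(t - 1)*(t - 1) = 2`. Both norm distances are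
less than `2`, and unitaries at distance less than `2` are joined by a path.

For subgroups `L ≤ K` of a topological group `G`, with `L` normal and relatively open in `K`, the
group `K / L` acts on `G / L` by right multiplication and `G / L → G / K` is the quotient covering
map of this action (`isQuotientCoveringMap_cosets`). When the total space of a quotient covering map
is connected, a deck transformation is determined by its value at one point, so the acting group is
the whole deck group (`exists_mulEquiv_deckGroup`). This applies to `L = ℋ_E` and `K = 𝒩_E`, since
the fibres of `u ↦ L_u(E)` are the left cosets of `𝒩_E` (`FaithfulNormalCondExp.orbitMap_eq_iff`).
-/

noncomputable section

namespace CondExp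

/-! ### Connectedness of the unitary group -/

section Operators

variable {H : Type*} [NormedAddCommGroup H] [InnerProductSpace ℂ H] [CompleteSpace H]

/-- The symmetry `2p - 1` is a sign of `a`. It is not given by the continuous functional calculus,
but it still commutes with everything that commutes with `a`, because `p` is the projection onto the
kernel of `a⁻`; hence it belongs to every von Neumann algebra containing `a`. -/
theorem exists_isStarProjection_mul_nonneg (a : H →L[ℂ] H) (ha : IsSelfAdjoint a) :
    ∃ p : H →L[ℂ] H, IsStarProjection p ∧ 0 ≤ (2 * p - 1) * a ∧
      ∀ T, Commute T a → Commute T p := by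
  let K : Submodule ℂ H := (a⁻).ker
  have hK : IsClosed (K : Set H) := (a⁻).isClosed_ker
  have : CompleteSpace K := hK.completeSpace_coe
  have hp : IsStarProjection K.starProjection := isStarProjection_starProjection
  have hmul (T : H →L[ℂ] H) (hT : a⁻ * T = 0) : K.starProjection * T = T := by
    ext x
    exact Submodule.starProjection_eq_self_iff.2 congr($hT x)
  have h0 : a⁻ * K.starProjection = 0 := by
    ext x
    exact K.starProjection_apply_mem x
  have h0' : K.starProjection * a⁻ = 0 := by
    have h := congrArg star h0
    rwa [star_mul, hp.isSelfAdjoint.star_eq, (CFC.negPart_nonneg a).isSelfAdjoint.star_eq,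
      star_zero] at h
  have hinv (T : H →L[ℂ] H) (hT : Commute T a) :
      K.starProjection * (T * K.starProjection) = T * K.starProjection := by
    have h : Commute T a⁻ := (hT.symm.cfcₙ_real (·⁻)).symm
    exact hmul _ (by rw [← mul_assoc, ← h.eq, mul_assoc, h0, mul_zero])
  refine ⟨K.starProjection, hp, ?_, fun T hT => ?_⟩
  · have h1 := hmul _ (CFC.negPart_mul_posPart a)
    have h2 : (2 * K.starProjection - 1) * a = a⁺ + a⁻ := by
      calc (2 * K.starProjection - 1) * a = (2 * K.starProjection - 1) * (a⁺ - a⁻) := by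
            rw [CFC.posPart_sub_negPart a]
        _ = 2 * (K.starProjection * a⁺) - 2 * (K.starProjection * a⁻) - a⁺ + a⁻ := by noncomm_ring
        _ = a⁺ + a⁻ := by rw [h1, h0']; noncomm_ring
    rw [h2]
    exact add_nonneg (CFC.posPart_nonneg a) (CFC.negPart_nonneg a)
  -- `T` and `T*` both preserve the range of the projection, so `T` commutes with it
  · have hT' : Commute (star T) a := by simpa [ha.star_eq] using hT.star_star
    have h := congrArg star (hinv _ hT')
    simp only [star_mul, star_star, hp.isSelfAdjoint.star_eq] at h
    exact (hinv T hT).symm.trans ((mul_assoc _ _ _).symm.trans h)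

/-- An intermediate point on a path from `1` to `u`: the unitary `t = i(2p - 1)`, where `2p - 1` is
a sign of `i(u* - u)`, is at distance at most `√2` from both. -/
theorem exists_unitary_norm_sub_lt_two (u : H →L[ℂ] H) (hu : u ∈ unitary (H →L[ℂ] H)) :
    ∃ t ∈ unitary (H →L[ℂ] H), (∀ T, Commute T u → Commute T (star u) → Commute T t) ∧
      ‖t - 1‖ < 2 ∧ ‖u - t‖ < 2 := by
  have bound (x : H →L[ℂ] H) (hx : star x * x ≤ 2) : ‖x‖ < 2 := by
    have h := CStarAlgebra.norm_le_norm_of_nonneg_of_le (star_mul_self_nonneg x) hx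
    rw [CStarRing.norm_star_mul_self] at h
    have h2 : ‖(2 : H →L[ℂ] H)‖ ≤ 2 := by
      simpa [one_add_one_eq_two] using (norm_add_le (1 : H →L[ℂ] H) 1).trans
        (add_le_add ContinuousLinearMap.norm_id_le ContinuousLinearMap.norm_id_le)
    nlinarith [norm_nonneg x]
  obtain ⟨p, hp, hpos, hcomm⟩ := exists_isStarProjection_mul_nonneg
    (Complex.I • (star u - u)) (by
      rw [isSelfAdjoint_iff, star_smul, star_sub, star_star]
      simp only [Complex.star_def, Complex.conj_I, smul_sub, neg_smul]
      abel)
  have hcomm' (T : H →L[ℂ] H) (h : Commute T u) (h' : Commute T (star u)) :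
      Commute T (2 * p - 1) := by
    have h1 := hcomm T ((h'.sub_right h).smul_right _)
    rw [two_mul]
    exact (h1.add_right h1).sub_right (Commute.one_right T)
  have hr : star (2 * p - 1) = 2 * p - 1 := by
    simp [two_mul, hp.isSelfAdjoint.star_eq]
  have hrr : (2 * p - 1) * (2 * p - 1) = 1 := by
    have h := hp.isIdempotentElem.eq
    calc (2 * p - 1) * (2 * p - 1) = 4 * (p * p) - 4 * p + 1 := by noncomm_ring
      _ = 1 := by rw [h]; simp
  have hur := hcomm' u (Commute.refl u)
    (by rw [commute_iff_eq, hu.1, hu.2])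
  generalize (2 * p - 1 : H →L[ℂ] H) = r at *
  have ht : star (Complex.I • r) = -(Complex.I • r) := by
    rw [star_smul, hr]; simp
  have htt : (Complex.I • r) * (Complex.I • r) = -1 := by
    simp [smul_smul, hrr]
  have hut : star u * (Complex.I • r) - (Complex.I • r) * u =
      r * (Complex.I • (star u - u)) := by
    have h : r * star u = star u * r := by
      have := congrArg star hur.eq
      rwa [star_mul, star_mul, hr] at this
    simp only [mul_smul_comm, smul_mul_assoc, mul_sub, smul_sub, h]
  refine ⟨Complex.I • r, ?_, fun T h h' => (hcomm' T h h').smul_right _, bound _ ?_, bound _ ?_⟩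
  · rw [Unitary.mem_iff, ht]
    simp only [neg_mul, mul_neg, htt, neg_neg, and_self]
  · refine le_of_eq ?_
    rw [star_sub, ht, star_one]
    generalize Complex.I • r = t at htt
    calc _ = -(t * t) + 1 := by noncomm_ring
      _ = 2 := by rw [htt]; norm_num
  -- `2 - (u - t)*(u - t) = u* t - t u = (2p - 1) i(u* - u)`
  · rw [← sub_nonneg]
    refine hpos.trans_eq ?_
    rw [← hut, star_sub, ht]
    generalize Complex.I • r = t at htt
    calc _ = 2 - 1 + -1 + (star u * t - t * u) := by norm_num
      _ = 2 - star u * u + t * t + (star u * t - t * u) := by rw [hu.1, htt]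
      _ = _ := by noncomm_ring

/-- Makes `M` a C⋆-algebra through `StarSubalgebra.cstarAlgebra`. -/
instance isClosed_vonNeumannAlgebra (M : VonNeumannAlgebra H) :
    IsClosed (M.toStarSubalgebra : Set (H →L[ℂ] H)) := by
  rw [VonNeumannAlgebra.coe_toStarSubalgebra, ← VonNeumannAlgebra.centralizer_centralizer]
  exact Set.isClosed_centralizer _

theorem mem_of_forall_commute (M : VonNeumannAlgebra H) (x : H →L[ℂ] H)
    (h : ∀ T ∈ M.commutant, Commute T x) : x ∈ M := by
  rw [← M.commutant_commutant, VonNeumannAlgebra.mem_commutant_iff]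
  exact h

theorem commute_of_mem_commutant {M : VonNeumannAlgebra H} {x T : H →L[ℂ] H}
    (hx : x ∈ M) (hT : T ∈ M.commutant) : Commute T x :=
  (VonNeumannAlgebra.mem_commutant_iff.1 hT x hx).symm

instance pathConnectedSpace_unitaryGroup (M : VonNeumannAlgebra H) :
    PathConnectedSpace (UnitaryGroup M) := by
  suffices h : ∀ u : UnitaryGroup M, Joined 1 u from
    ⟨⟨1⟩, fun u v => (h u).symm.trans (h v)⟩
  intro u
  have hu : ((u : M.toStarSubalgebra) : H →L[ℂ] H) ∈ unitary (H →L[ℂ] H) :=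
    Unitary.map_mem M.toStarSubalgebra.subtype u.2
  obtain ⟨t, ht, htc, h1, h2⟩ := exists_unitary_norm_sub_lt_two _ hu
  have htM : t ∈ M := mem_of_forall_commute M t fun T hT =>
    htc T (commute_of_mem_commutant u.1.2 hT)
      (commute_of_mem_commutant (star_mem (S := VonNeumannAlgebra H) u.1.2) hT)
  let t' : UnitaryGroup M := ⟨⟨t, htM⟩, Subtype.ext ht.1, Subtype.ext ht.2⟩
  exact (Unitary.joined (A := M.toStarSubalgebra) 1 t' h1).trans
    (Unitary.joined (A := M.toStarSubalgebra) t' u h2)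

end Operators

/-! ### Polar decomposition of invertible elements -/

/-- Polar decomposition `x = v h` of an invertible element, with `h = (x* x)^(1/2)`. Of `h`, only its
invertibility and the elements commuting with it are recorded. -/
theorem exists_polar_of_isUnit {A : Type*} [CStarAlgebra A] [PartialOrder A] [StarOrderedRing A]
    {x : A} (hx : IsUnit x) :
    ∃ v ∈ unitary A, ∃ h : A, IsUnit h ∧ x = v * h ∧
      ∀ T, Commute T (star x * x) → Commute T h := by
  obtain ⟨h, hhu, hh, hs, hcomm⟩ : ∃ h : A, IsUnit h ∧ h * h = star x * x ∧ star h = h ∧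
      ∀ T, Commute T (star x * x) → Commute T h :=
    ⟨CFC.sqrt (star x * x), (CFC.isUnit_sqrt_iff (star x * x)).2 (hx.star.mul hx),
      CFC.sqrt_mul_sqrt_self (star x * x) (star_mul_self_nonneg x),
      (CFC.sqrt_nonneg (star x * x)).isSelfAdjoint.star_eq,
      fun T hT => (hT.symm.cfcₙ_nnreal NNReal.sqrt).symm⟩
  obtain ⟨h, rfl⟩ := hhu
  have hs' : star (↑h⁻¹ : A) = ↑h⁻¹ := by
    rw [← Units.coe_star_inv, show star h = h from Units.ext hs]
  have hv1 : star (x * ↑h⁻¹) * (x * ↑h⁻¹) = 1 := by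
    rw [star_mul, hs']
    calc _ = ↑h⁻¹ * (star x * x) * (↑h⁻¹ : A) := by simp only [mul_assoc]
      _ = 1 := by rw [← hh]; simp
  have hv2 : (x * ↑h⁻¹) * star (x * ↑h⁻¹) = 1 := by
    obtain ⟨w, hw⟩ := hx.mul (h⁻¹).isUnit
    rw [← hw] at hv1 ⊢
    rw [← Units.inv_eq_of_mul_eq_one_left hv1]
    exact w.mul_inv
  exact ⟨x * ↑h⁻¹, ⟨hv1, hv2⟩, h, h.isUnit, by simp, hcomm⟩

/-! ### Coset spaces and quotient coverings -/

section Cosets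

open Topology

variable {G : Type*} [Group G] {L K : Subgroup G} [hn : (L.subgroupOf K).Normal]

/-- The action of `K / L` on the left coset space `G / L` by right multiplication,
`gL • uL = u g⁻¹ L`, for a subgroup `L ≤ K` that is normal in `K`. The inverse makes it a left
action. -/
abbrev cosetRightAction (hLK : L ≤ K) : MulAction (K ⧸ L.subgroupOf K) (G ⧸ L) where
  smul := Quotient.map₂ (fun (g : K) (u : G) => u * (g : G)⁻¹) <| by
    intro g g' hg u u' hu
    have hg : g⁻¹ * g' ∈ L.subgroupOf K := QuotientGroup.leftRel_apply.1 hg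
    have hu : u⁻¹ * u' ∈ L := QuotientGroup.leftRel_apply.1 hu
    have h1 := hn.conj_mem ⟨u⁻¹ * u', hLK hu⟩ hu g
    have h2 := hn.mem_comm hg
    have h3 := mul_mem h1 (inv_mem h2)
    refine QuotientGroup.leftRel_apply.2 ?_
    simpa [Subgroup.mem_subgroupOf, mul_assoc] using h3
  one_smul := by
    rintro ⟨u⟩
    exact congrArg (QuotientGroup.mk (s := L)) (by simp)
  mul_smul := by
    rintro ⟨g⟩ ⟨g'⟩ ⟨u⟩
    exact congrArg (QuotientGroup.mk (s := L)) (by simp [mul_assoc])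

/-- If `L` is a neighbourhood of `1` in `K` (as witnessed by `U`), then any quotient map from `G / L`
whose fibres come from the left cosets of `K` is a quotient covering map for the action of
`K / L`. -/
theorem isQuotientCoveringMap_cosets [TopologicalSpace G] [IsTopologicalGroup G] {Y : Type*}
    [TopologicalSpace Y] (hLK : L ≤ K) {U : Set G} (hU : U ∈ 𝓝 1) (hUL : ∀ u ∈ U, u ∈ K → u ∈ L)
    {p : G ⧸ L → Y} (hp : IsQuotientMap p)
    (hpK : ∀ u v : G, p (QuotientGroup.mk u) = p (QuotientGroup.mk v) ↔ u⁻¹ * v ∈ K) :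
    letI := cosetRightAction hLK
    IsQuotientCoveringMap p (K ⧸ L.subgroupOf K) := by
  let := cosetRightAction hLK
  refine { hp with
    continuous_const_smul := ?_
    apply_eq_iff_mem_orbit := ?_
    disjoint := ?_ }
  · rintro ⟨g⟩
    refine QuotientGroup.isOpenQuotientMap_mk.isQuotientMap.continuous_iff.2 ?_
    exact QuotientGroup.continuous_mk.comp (continuous_mul_const (g : G)⁻¹)
  · rintro ⟨u⟩ ⟨v⟩
    refine (hpK u v).trans ⟨fun h => ⟨QuotientGroup.mk ⟨u⁻¹ * v, h⟩, ?_⟩, ?_⟩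
    · exact congrArg (QuotientGroup.mk (s := L)) (by simp)
    · rintro ⟨⟨g⟩, h⟩
      have h : (v * (g : G)⁻¹)⁻¹ * u ∈ L := QuotientGroup.eq.1 h
      have h1 := K.mul_mem (K.inv_mem (hLK h)) g.2
      simpa [mul_assoc] using h1
  · rintro ⟨u⟩
    obtain ⟨V, hV, hVU⟩ : ∃ V ∈ 𝓝 (1 : G), ∀ x ∈ V, ∀ y ∈ V, x⁻¹ * y ∈ U := by
      have hc : Filter.Tendsto (fun z : G × G => z.1⁻¹ * z.2) (𝓝 1 ×ˢ 𝓝 1) (𝓝 1) := by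
        have : Continuous fun z : G × G => z.1⁻¹ * z.2 := by fun_prop
        simpa [nhds_prod_eq] using this.tendsto (1, 1)
      obtain ⟨V, hV, h⟩ := (Filter.basis_sets _).prod_self.mem_iff.1 (hc hU)
      exact ⟨V, hV, fun x hx y hy => h (Set.mk_mem_prod hx hy)⟩
    -- if `gL` moves `u x L` to `u y L`, then `y⁻¹ x ∈ U ∩ K` lies in `L`, and hence so does `g`
    refine ⟨(fun x => QuotientGroup.mk (u * x)) '' V, ?_, ?_⟩
    · have h : IsOpenMap fun x : G => (QuotientGroup.mk (u * x) : G ⧸ L) :=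
        QuotientGroup.isOpenMap_coe.comp (isOpenMap_mul_left u)
      have h1 := h.image_mem_nhds hV
      rwa [mul_one] at h1
    · rintro ⟨g⟩ ⟨_, ⟨_, ⟨x, hx, rfl⟩, rfl⟩, ⟨y, hy, h⟩⟩
      have h : (u * y)⁻¹ * (u * x * (g : G)⁻¹) ∈ L := QuotientGroup.eq.1 h
      have h1 : y⁻¹ * x * (g : G)⁻¹ ∈ L := by simpa [mul_assoc] using h
      have h2 : y⁻¹ * x ∈ L := hUL _ (hVU y hy x hx) (by simpa using K.mul_mem (hLK h1) g.2)
      have h3 : (g : G) ∈ L := by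
        simpa [mul_assoc] using L.mul_mem (L.inv_mem h1) h2
      exact (QuotientGroup.eq_one_iff g).2 h3

end Cosets

/-! ### Covering transformations -/

section Deck

variable {X Y W : Type*} [TopologicalSpace X] [TopologicalSpace Y] [Group W] [MulAction W X]
  {p : X → Y}

/-- The group acting in a quotient covering map with connected total space is the group of all
covering transformations. -/
theorem exists_mulEquiv_deckGroup [ConnectedSpace X] (hp : IsQuotientCoveringMap p W) :
    ∃ θ : W ≃* deckGroup p, ∀ (w : W) (x : X), (θ w : X ≃ₜ X) x = w • x := by
  have := hp.toContinuousConstSMul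
  have := hp.isCancelSMul
  let θ : W →* deckGroup p :=
    { toFun w := ⟨Homeomorph.smul w, fun x => hp.map_smul w⟩
      map_one' := Subtype.ext (Homeomorph.ext fun x => one_smul W x)
      map_mul' v w := Subtype.ext (Homeomorph.ext fun x => mul_smul v w x) }
  obtain ⟨x₀⟩ : Nonempty X := inferInstance
  refine ⟨MulEquiv.ofBijective θ ⟨fun v w h => ?_, fun f => ?_⟩, fun w x => rfl⟩
  · exact IsCancelSMul.right_cancel v w x₀ congr(($h : X ≃ₜ X) x₀)
  · obtain ⟨w, hw⟩ := hp.apply_eq_iff_mem_orbit.1 (f.2 x₀)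
    refine ⟨w, Subtype.ext (Homeomorph.ext fun x => ?_)⟩
    refine congrFun (hp.isCoveringMap.eq_of_comp_eq (Homeomorph.continuous _) f.1.continuous
      (funext fun x => ?_) x₀ hw) x
    exact (hp.map_smul w).trans (f.2 x).symm

end Deck

/-! ### The unitary orbit of a conditional expectation -/

namespace FaithfulNormalCondExp

variable {H : Type*} [NormedAddCommGroup H] [InnerProductSpace ℂ H] [CompleteSpace H]
variable {N M : VonNeumannAlgebra H} {hNM : N ≤ M} (E : FaithfulNormalCondExp hNM)

theorem orbitMap_eq_iff (u v : UnitaryGroup M) :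
    E.orbitMap u = E.orbitMap v ↔ u⁻¹ * v ∈ E.normalizer := by
  have hu := Unitary.mul_star_self_of_mem u.2
  have hu' := Unitary.star_mul_self_of_mem u.2
  have hv := Unitary.mul_star_self_of_mem v.2
  have hv' := Unitary.star_mul_self_of_mem v.2
  have h1 : E.orbitMap u = E.orbitMap v ↔ ∀ x : M.toStarSubalgebra,
      (u : M.toStarSubalgebra) * E.toCLM (star (u : M.toStarSubalgebra) * x * u) *
        star (u : M.toStarSubalgebra) =
      (v : M.toStarSubalgebra) * E.toCLM (star (v : M.toStarSubalgebra) * x * v) *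
        star (v : M.toStarSubalgebra) := by
    simp only [← conjAction_apply]
    exact Subtype.ext_iff.trans ContinuousLinearMap.ext_iff
  have h2 : u⁻¹ * v ∈ E.normalizer ↔ ∀ x : M.toStarSubalgebra,
      E.toCLM (star (u : M.toStarSubalgebra) * v * x * star (star (u : M.toStarSubalgebra) * v)) =
        star (u : M.toStarSubalgebra) * v * E.toCLM x * star (star (u : M.toStarSubalgebra) * v) :=
    Iff.rfl
  rw [h1, h2]
  generalize (u : M.toStarSubalgebra) = a at *
  generalize (v : M.toStarSubalgebra) = b at *
  simp only [star_mul, star_star]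
  constructor
  · intro h x
    have key := congrArg (fun z => star a * z * a) (h (b * x * star b))
    have e1 : star b * (b * x * star b) * b = x := by
      calc _ = (star b * b) * x * (star b * b) := by simp only [mul_assoc]
        _ = x := by rw [hv', one_mul, mul_one]
    have e2 (y : M.toStarSubalgebra) : star a * (a * y * star a) * a = y := by
      calc _ = (star a * a) * y * (star a * a) := by simp only [mul_assoc]
        _ = y := by rw [hu', one_mul, mul_one]
    simp only [e1, e2] at key
    simpa only [mul_assoc] using key
  · intro h x
    have key := h (star b * x * b)
    have e1 : star a * b * (star b * x * b) * (star b * a) = star a * x * a := by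
      calc _ = star a * (b * star b) * x * (b * star b) * a := by simp only [mul_assoc]
        _ = _ := by rw [hv, mul_one, mul_one]
    rw [e1] at key
    rw [key]
    calc _ = (a * star a) * b * E.toCLM (star b * x * b) * star b * (a * star a) := by
          simp only [mul_assoc]
      _ = _ := by rw [hu, one_mul, mul_one]

theorem isQuotientMap_orbitMap : Topology.IsQuotientMap E.orbitMap :=
  ⟨⟨rfl⟩, fun y => by obtain ⟨_, u, rfl⟩ := y; exact ⟨u, rfl⟩⟩

theorem isQuotientMap_coveringProj : Topology.IsQuotientMap E.coveringProj :=
  .of_comp QuotientGroup.continuous_mk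
    (QuotientGroup.isOpenQuotientMap_mk.isQuotientMap.continuous_iff.2 E.isQuotientMap_orbitMap.continuous)
    E.isQuotientMap_orbitMap

theorem exists_homeomorph_quotient_normalizer :
    ∃ h : (UnitaryGroup M ⧸ E.normalizer) ≃ₜ E.UnitaryOrbit,
      ∀ u : UnitaryGroup M, h (QuotientGroup.mk u) = E.orbitMap u := by
  let f : UnitaryGroup M ⧸ E.normalizer → E.UnitaryOrbit :=
    Quotient.lift E.orbitMap fun u v huv =>
      (E.orbitMap_eq_iff u v).2 (QuotientGroup.leftRel_apply.1 huv)
  have hf : IsHomeomorph f := by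
    refine isHomeomorph_iff_isQuotientMap_injective.2 ⟨?_, ?_⟩
    · exact .of_comp QuotientGroup.continuous_mk
        (QuotientGroup.isOpenQuotientMap_mk.isQuotientMap.continuous_iff.2 E.isQuotientMap_orbitMap.continuous)
        E.isQuotientMap_orbitMap
    · rintro ⟨u⟩ ⟨v⟩ h
      exact QuotientGroup.eq.2 ((E.orbitMap_eq_iff u v).1 h)
  exact ⟨hf.homeomorph f, fun u => rfl⟩

/-- The factorization `u = v w` has for `v` the unitary part of `E(u)`, which induces the same
automorphism of `N` as `u`. -/
theorem mem_prodSubgroup_of_isUnit {u : UnitaryGroup M} (hu : u ∈ E.normalizer)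
    (hunit : IsUnit (E.toCLM u : H →L[ℂ] H)) : u ∈ E.prodSubgroup := by
  obtain ⟨V, hV, h, hh, hx, hcomm⟩ := exists_polar_of_isUnit hunit
  -- `θ(n) = u n u*` maps `N` into itself
  have hθ (n : M.toStarSubalgebra) (hn : (n : H →L[ℂ] H) ∈ N) :
      (((u : M.toStarSubalgebra) * n * star (u : M.toStarSubalgebra) : M.toStarSubalgebra) :
        H →L[ℂ] H) ∈ N := by
    have h1 := hu n
    rw [E.apply_of_mem' n hn] at h1
    rw [← h1]
    exact E.mem' _
  -- apply `E` to `u n = θ(n) u`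
  have hxn (n : M.toStarSubalgebra) (hn : (n : H →L[ℂ] H) ∈ N) :
      E.toCLM u * n = (u * n * star (u : M.toStarSubalgebra)) * E.toCLM u := by
    have h1 := E.bimodule' 1 u n (one_mem N) hn
    have h2 := E.bimodule' _ u 1 (hθ n hn) (one_mem N)
    rw [one_mul, one_mul] at h1
    rw [mul_one, mul_one] at h2
    rw [← h1, ← h2, mul_assoc _ (star _), Unitary.star_mul_self_of_mem u.2, mul_one]
  have hVn (n : M.toStarSubalgebra) (hn : (n : H →L[ℂ] H) ∈ N) :
      V * n = ((u * n * star (u : M.toStarSubalgebra) : M.toStarSubalgebra) : H →L[ℂ] H) * V := by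
    have h1 : (E.toCLM u : H →L[ℂ] H) * n = _ * (E.toCLM u : H →L[ℂ] H) :=
      congrArg Subtype.val (hxn n hn)
    -- the adjoint relation at `n*` makes `n` commute with `x* x`, where `x = E(u)`
    have h2 : n * star (E.toCLM u) =
        star (E.toCLM u) * (u * n * star (u : M.toStarSubalgebra)) := by
      simpa [mul_assoc] using congrArg star (hxn (star n) (star_mem (S := VonNeumannAlgebra H) hn))
    have h3 : (n : H →L[ℂ] H) * star (E.toCLM u : H →L[ℂ] H) =
        star (E.toCLM u : H →L[ℂ] H) *
          ((u * n * star (u : M.toStarSubalgebra) : M.toStarSubalgebra) : H →L[ℂ] H) :=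
      congrArg Subtype.val h2
    generalize ((u * n * star (u : M.toStarSubalgebra) : M.toStarSubalgebra) : H →L[ℂ] H) = y
      at h1 h3 ⊢
    have h4 : Commute (n : H →L[ℂ] H) (star (E.toCLM u : H →L[ℂ] H) * E.toCLM u) := by
      rw [commute_iff_eq, ← mul_assoc, h3, mul_assoc, mul_assoc, h1]
    refine hh.mul_right_cancel ?_
    rw [mul_assoc, (hcomm _ h4).eq, ← mul_assoc, ← hx, h1, mul_assoc, ← hx]
  have hVN : V ∈ N := by
    refine mem_of_forall_commute N V fun T hT => hh.mul_right_cancel ?_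
    have h1 := commute_of_mem_commutant (E.mem' u) hT
    have h2 := commute_of_mem_commutant (star_mem (S := VonNeumannAlgebra H) (E.mem' u)) hT
    rw [mul_assoc, ← hx, h1.eq, mul_assoc, (hcomm T (h2.mul_right h1)).eq, ← mul_assoc, ← hx]
  let v : UnitaryGroup M := ⟨⟨V, hNM hVN⟩, Subtype.ext hV.1, Subtype.ext hV.2⟩
  have hv : v ∈ E.prodSubgroup := ⟨v, hVN, 1, one_mem _, mul_one v⟩
  -- `w = v* u` normalizes `E` and commutes with `N`
  have hw := mul_mem (inv_mem (E.prodSubgroup_le_normalizer hv)) hu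
  have hwn (n : M.toStarSubalgebra) (hn : (n : H →L[ℂ] H) ∈ N) :
      n * (v⁻¹ * u : UnitaryGroup M) = (v⁻¹ * u : UnitaryGroup M) * n := by
    have h1 : (v : M.toStarSubalgebra) * n = (u * n * star (u : M.toStarSubalgebra)) * v :=
      Subtype.ext (hVn n hn)
    have hv1 := Unitary.star_mul_self_of_mem v.2
    have hv2 := Unitary.mul_star_self_of_mem v.2
    have hu1 := Unitary.star_mul_self_of_mem u.2
    change n * (star (v : M.toStarSubalgebra) * u) = star (v : M.toStarSubalgebra) * u * n
    generalize (v : M.toStarSubalgebra) = b at *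
    generalize (u : M.toStarSubalgebra) = a at *
    calc _ = star b * (b * n) * star b * a := by rw [← mul_assoc (star b), hv1]; simp [mul_assoc]
      _ = star b * a * n * star a * (b * star b) * a := by rw [h1]; simp only [mul_assoc]
      _ = star b * a * n * (star a * a) := by rw [hv2, mul_one, mul_assoc]
      _ = _ := by rw [hu1, mul_one]
  refine ⟨v, hVN, v⁻¹ * u, ⟨?_, fun m => ?_⟩, mul_inv_cancel_left v u⟩
  · rw [VonNeumannAlgebra.mem_commutant_iff]
    exact fun n hn => congrArg Subtype.val (hwn ⟨n, hNM hn⟩ hn)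
  -- `E(w m) = E(w (m w) w*) = w E(m w) w* = E(m w)`
  · generalize v⁻¹ * u = w at hw hwn ⊢
    have h1 := hw (m * w)
    have hw2 := Unitary.mul_star_self_of_mem w.2
    rw [← hwn _ (E.mem' _), mul_assoc, mul_assoc, mul_assoc, hw2, mul_one, mul_one] at h1
    exact h1

/-- `ℋ_E` is relatively open in `𝒩_E`: invertibility of `E(u)` is an open condition that holds at
`u = 1`. -/
theorem exists_mem_nhds_one_inter_normalizer :
    ∃ U ∈ nhds (1 : UnitaryGroup M), ∀ u ∈ U, u ∈ E.normalizer → u ∈ E.prodSubgroup := by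
  have hc : Continuous fun u : UnitaryGroup M =>
      (E.toCLM (u : M.toStarSubalgebra) : H →L[ℂ] H) :=
    continuous_subtype_val.comp (E.toCLM.continuous.comp continuous_subtype_val)
  refine ⟨_, (Units.isOpen.preimage hc).mem_nhds ?_, fun u h hu =>
    E.mem_prodSubgroup_of_isUnit hu h⟩
  have h1 : E.toCLM 1 = 1 := E.apply_of_mem' 1 (one_mem N)
  change IsUnit (E.toCLM 1 : H →L[ℂ] H)
  rw [h1]
  exact isUnit_one

end FaithfulNormalCondExp
end CondExp
end

open CondExp
theorem mainTheorem1 {H : Type*} [NormedAddCommGroup H] [InnerProductSpace ℂ H] [CompleteSpace H]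
    {N M : VonNeumannAlgebra H} (hNM : N ≤ M) (E : FaithfulNormalCondExp hNM) :
    IsCoveringMap E.coveringProj ∧ Function.Surjective E.coveringProj ∧
    (∃ h : (UnitaryGroup M ⧸ E.normalizer) ≃ₜ E.UnitaryOrbit,
      ∀ u : UnitaryGroup M, h (QuotientGroup.mk u) = E.orbitMap u) ∧
    ∃ θ : E.WeylGroup ≃* deckGroup E.coveringProj,
      ∀ (g : E.normalizer) (u : UnitaryGroup M),
        (θ (QuotientGroup.mk g) : E.CoveringSpace ≃ₜ E.CoveringSpace) (QuotientGroup.mk u) =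
          QuotientGroup.mk (u * (g : UnitaryGroup M)⁻¹) := by
  obtain ⟨U, hU, hUL⟩ := E.exists_mem_nhds_one_inter_normalizer
  let := cosetRightAction E.prodSubgroup_le_normalizer
  have hcov : IsQuotientCoveringMap E.coveringProj E.WeylGroup :=
    isQuotientCoveringMap_cosets E.prodSubgroup_le_normalizer hU hUL
      E.isQuotientMap_coveringProj E.orbitMap_eq_iff
  have : ConnectedSpace E.CoveringSpace :=
    QuotientGroup.mk_surjective.connectedSpace QuotientGroup.continuous_mk
  obtain ⟨θ, hθ⟩ := exists_mulEquiv_deckGroup hcov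
  exact ⟨hcov.isCoveringMap, hcov.surjective, E.exists_homeomorph_quotient_normalizer, θ,
    fun g u => hθ _ _⟩
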